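/- **Definitions.** A meet semilattice $L$ is *distributive* if whenever $b_1\wedge b_2\le a$ there are $c_1\ge b_1$ and $c_2\ge b_2$ with $a=c_1\wedge c_2$. Let $\mathsf{DM}$ be the category of distributive meet semilattices with top $\top$ (not necessarily with bottom) and maps preserving $\wedge$ and $\top$. An *implicative meet semilattice* is a meet semilattice with top in which every map $a\wedge(-)$ has a right adjoint $a\to(-)$. Let $\mathsf{IM}$ be the category of implicative meet semilattices and maps preserving $\wedge$ and $\to$. A *Priestley space* is a compact ordered (by a partial order) topological space in which, whenever $x\not\le y$, some clopen upset contains $x$ and not $y$. Let $X_0$ be a subset of a Priestley space $X$. Denote by $X^*$ the set of all clopen upsets $U$ of $X$ such that every maximal element of $X\setminus U$ lies in $X_0$, and for $x\in X$ put $\mathcal I_x=\{U\in X^*: x\notin U\}$. The pair $(X,X_0)$ is a *$*$-generalized Priestley space* if 1. $X$ is a Priestley space and $X_0$ is dense in $X$; 2. for all $x\in X$: $x\in X_0$ if and only if $\mathcal I_x$ is nonempty and directed (under inclusion); 3. for all $x,y\in X$: $x\le y$ if and only if every $U\in X^*$ with $x\in U$ satisfies $y\in U$. For a relation $R\subseteq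 X\times Y$ put $R[x]=\{y: x\mathrel R y\}$ and $\Box_RA=\{x\in X: R[x]\subseteq A\}$ for $A\subseteq Y$. A *generalized Priestley morphism* from $X$ to $Y$ is a relation $R\subseteq X\times Y$ such that (i) if $(x,y)\notin R$, then there is $U\in Y^*$ with $R[x]\subseteq U$ and $y\notin U$; (ii) $\Box_RU\in X^*$ for every $U\in Y^*$. The composite of $R\subseteq X\times Y$ and $S\subseteq Y\times Z$ is the relation $S*R$ given by $$x\,(S*R)\,z\iff(\forall U\in Z^*)\,(x\in\Box_R\Box_SU\Rightarrow z\in U),$$ and the identity of $X$ is $\le_X$. This gives the category $\mathsf{GPS}^*$ of $*$-generalized Priestley spaces and generalized Priestley morphisms. A *$*$-generalized Esakia space* is a $*$-generalized Priestley space $X$ such that the downset ${\downarrow}W$ is clopen for every finite union $W=\bigcup_{i=1}^n(U_i\setminus V_i)$ with $U_i,V_i\in X^*$. A *generalized Esakia morphism* from $X$ to $Y$ is a generalized Priestley morphism $R\subseteq X\times Y$ such that whenever $x\mathrel R y$ with $y\in Y_0$, there is $z\in X_0$ with $x\le z$ and $R[z]={\uparrow}y$. Let $\mathsf{GES}^*$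 be the category of $*$-generalized Esakia spaces and generalized Esakia morphisms, with the same composition and identities. **Theorem.** 1. $\mathsf{DM}$ is dually equivalent to $\mathsf{GPS}^*$. 2. $\mathsf{IM}$ is dually equivalent to $\mathsf{GES}^*$. -/

import Mathlib

open CategoryTheory

universe u

namespace MeetDuality

/-! ## Distributive and implicative meet semilattices -/

/-- A meet semilattice is distributive if every `a ≥ b₁ ⊓ b₂` is of the form `c₁ ⊓ c₂` with
`b₁ ≤ c₁` and `b₂ ≤ c₂`. -/
def IsDistributiveMeet (L : Type u) [SemilatticeInf L] : Prop :=
  ∀ a b₁ b₂ : L, b₁ ⊓ b₂ ≤ a → ∃ c₁ c₂ : L, b₁ ≤ c₁ ∧ b₂ ≤ c₂ ∧ a = c₁ ⊓ c₂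

/-- The category of distributive meet semilattices with top; it is the full subcategory of
Mathlib's category of meet semilattices with top and maps preserving finite meets and top. -/
abbrev DM : Type (u + 1) :=
  ObjectProperty.FullSubcategory (fun L : SemilatInfCat.{u} => IsDistributiveMeet L)

/-- An implicative meet semilattice: a meet semilattice with top in which each map `b ⊓ -` has a
right adjoint `b ⇨ -`. No bottom and no joins are required. -/
class ImplicativeSemilattice (L : Type u) extends SemilatticeInf L, OrderTop L, HImp L where
  le_himp_iff (a b c : L) : a ≤ b ⇨ c ↔ a ⊓ b ≤ c

/-- A homomorphism of implicative meet semilattices: it preserves binary meets and implication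
(hence also the top, which is `a ⇨ a`). -/
structure ImplicativeHom (L K : Type u) [ImplicativeSemilattice L] [ImplicativeSemilattice K]
    extends InfHom L K where
  map_himp' (a b : L) : toFun (a ⇨ b) = toFun a ⇨ toFun b

theorem ImplicativeHom.ext {L K : Type u} [ImplicativeSemilattice L] [ImplicativeSemilattice K]
    {f g : ImplicativeHom L K} (h : f.toInfHom = g.toInfHom) : f = g := by
  cases f; cases g; cases h; rfl

/-- Bundled implicative meet semilattices. -/
structure IM : Type (u + 1) where
  carrier : Type u
  [str : ImplicativeSemilattice carrier]

attribute [instance] IM.str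

/-- The category of implicative meet semilattices and their homomorphisms. -/
instance IM.category : Category.{u} IM.{u} where
  Hom L K := ImplicativeHom L.carrier K.carrier
  id L := ⟨InfHom.id L.carrier, fun _ _ => rfl⟩
  comp f g := ⟨g.toInfHom.comp f.toInfHom, fun a b =>
    (congrArg g.toFun (f.map_himp' a b)).trans (g.map_himp' (f.toFun a) (f.toFun b))⟩
  id_comp _ := rfl
  comp_id _ := rfl
  assoc _ _ _ := rfl

/-! ## Admissible clopen upsets -/

section Admissible

variable {X : Type u} [TopologicalSpace X] [PartialOrder X]

/-- `U` is an admissible clopen upset with respect to `X₀`: a clopen upset such that all maximal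
points of its complement lie in `X₀`. The collection of these is `X^*`. -/
def Admissible (X₀ : Set X) (U : Set X) : Prop :=
  IsClopen U ∧ IsUpperSet U ∧ {x | Maximal (fun y => y ∈ Uᶜ) x} ⊆ X₀

/-- The family `𝓘_x` of the admissible clopen upsets that do not contain `x`. -/
def avoiding (X₀ : Set X) (x : X) : Set (Set X) :=
  {U | Admissible X₀ U ∧ x ∉ U}

/-- `U` is Esakia clopen: a finite union of differences of admissible clopen upsets. -/
def EsakiaClopen (X₀ : Set X) (U : Set X) : Prop :=
  ∃ (n : ℕ) (A B : Fin n → Set X),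
    (∀ i, Admissible X₀ (A i)) ∧ (∀ i, Admissible X₀ (B i)) ∧ U = ⋃ i, A i \ B i

end Admissible

/-- For a relation `R` from `X` to `Y`, `box R A` is the set of all `x` with `R[x] ⊆ A`. -/
def box {X Y : Type u} (R : X → Y → Prop) (A : Set Y) : Set X :=
  {x | ∀ y, R x y → y ∈ A}

/-! ## `*`-generalized Priestley spaces -/

/-- A `*`-generalized Priestley space: a compact ordered space satisfying the Priestley separation
axiom, with a distinguished dense subset `base` (written `X₀`). -/
structure GPSStar : Type (u + 1) where
  carrier : Type u
  [top : TopologicalSpace carrier]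
  [order : PartialOrder carrier]
  [compact : CompactSpace carrier]
  [priestley : PriestleySpace carrier]
  base : Set carrier
  dense_base : Dense base
  mem_base_iff (x : carrier) :
    x ∈ base ↔ (avoiding base x).Nonempty ∧ DirectedOn (· ⊆ ·) (avoiding base x)
  le_iff (x y : carrier) : x ≤ y ↔ ∀ U, Admissible base U → x ∈ U → y ∈ U

attribute [instance] GPSStar.top GPSStar.order GPSStar.compact GPSStar.priestley

/-- A generalized Priestley morphism: a relation `R` such that non-related pairs are separated by
an admissible clopen upset, and such that `box R` maps admissible clopen upsets to such. -/
@[ext]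
structure GPMorphism (X Y : GPSStar.{u}) : Type u where
  rel : X.carrier → Y.carrier → Prop
  separated (x : X.carrier) (y : Y.carrier) : ¬ rel x y →
    ∃ U, Admissible Y.base U ∧ y ∉ U ∧ {z | rel x z} ⊆ U
  admissible_box (U : Set Y.carrier) : Admissible Y.base U → Admissible X.base (box rel U)

/-- The composite `S ∗ R` of `R` from `X` to `Y` and `S` from `Y` to `Z`; in general it is larger
than the set-theoretic composite. -/
def star {X Y : Type u} (Z : GPSStar.{u}) (R : X → Y → Prop) (S : Y → Z.carrier → Prop) :
    X → Z.carrier → Prop :=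
  fun x z => ∀ U, Admissible Z.base U → x ∈ box R (box S U) → z ∈ U

section Helpers

variable {X : Type u} [TopologicalSpace X] [PartialOrder X]

theorem box_mono {X Y : Type u} (R : X → Y → Prop) {A B : Set Y} (h : A ⊆ B) :
    box R A ⊆ box R B :=
  fun _ hx y hy => h (hx y hy)

theorem admissible_univ (X₀ : Set X) : Admissible X₀ Set.univ :=
  ⟨isClopen_univ, isUpperSet_univ, fun _ hx => (hx.1 trivial).elim⟩

theorem Admissible.inter {X₀ U V : Set X} (hU : Admissible X₀ U) (hV : Admissible X₀ V) :
    Admissible X₀ (U ∩ V) := by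
  refine ⟨hU.1.inter hV.1, hU.2.1.inter hV.2.1, fun x hx => ?_⟩
  by_cases h : x ∈ U
  · exact hV.2.2 ⟨fun h' => hx.1 ⟨h, h'⟩, fun y hy hxy => hx.2 (fun h' => hy h'.2) hxy⟩
  · exact hU.2.2 ⟨h, fun y hy hxy => hx.2 (fun h' => hy h'.1) hxy⟩

theorem isClosed_Ici' [PriestleySpace X] (x : X) : IsClosed (Set.Ici x) := by
  rw [← isOpen_compl_iff, isOpen_iff_mem_nhds]
  intro y hy
  obtain ⟨U, hU, hU', hx, hyU⟩ := exists_isClopen_upper_of_not_le (show ¬ x ≤ y from hy)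
  exact Filter.mem_of_superset (hU.compl.isOpen.mem_nhds hyU)
    (fun z hz hxz => hz (hU' hxz hx))

theorem exists_maximal_ge [CompactSpace X] [PriestleySpace X] {C : Set X} (hC : IsClosed C)
    {x : X} (hx : x ∈ C) : ∃ m, x ≤ m ∧ Maximal (fun y => y ∈ C) m := by
  refine zorn_le_nonempty₀ C (fun c hc hchain y hy => ?_) x hx
  have : Nonempty c := ⟨⟨y, hy⟩⟩
  have hcl : ∀ z : c, IsClosed (C ∩ Set.Ici (z : X)) := fun z => hC.inter (isClosed_Ici' _)
  obtain ⟨w, hw⟩ := IsCompact.nonempty_iInter_of_directed_nonempty_isCompact_isClosed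
    (fun z : c => C ∩ Set.Ici (z : X))
    (fun a b => by
      rcases hchain.total a.2 b.2 with h | h
      · exact ⟨b, Set.inter_subset_inter_right _ (Set.Ici_subset_Ici.2 h), subset_rfl⟩
      · exact ⟨a, subset_rfl, Set.inter_subset_inter_right _ (Set.Ici_subset_Ici.2 h)⟩)
    (fun z => ⟨z, hc z.2, le_rfl⟩) (fun z => (hcl z).isCompact) hcl
  rw [Set.mem_iInter] at hw
  exact ⟨w, (hw ⟨y, hy⟩).1, fun z hz => (hw ⟨z, hz⟩).2⟩

theorem box_star {X Y Z : GPSStar.{u}} (R : X.carrier → Y.carrier → Prop)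
    (S : Y.carrier → Z.carrier → Prop) {U : Set Z.carrier} (hU : Admissible Z.base U) :
    box (star Z R S) U = box R (box S U) := by
  apply Set.Subset.antisymm
  · intro x hx
    by_contra hxU
    let F := {V : Set Z.carrier // Admissible Z.base V ∧ x ∈ box R (box S V)}
    have : Nonempty F := ⟨⟨Set.univ, admissible_univ _, fun _ _ _ _ => trivial⟩⟩
    have hcl : ∀ V : F, IsClosed ((V : Set Z.carrier) ∩ Uᶜ) :=
      fun V => V.2.1.1.isClosed.inter hU.1.compl.isClosed
    obtain ⟨z, hz⟩ := IsCompact.nonempty_iInter_of_directed_nonempty_isCompact_isClosed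
      (fun V : F => (V : Set Z.carrier) ∩ Uᶜ)
      (fun A B => ⟨⟨A.1 ∩ B.1, A.2.1.inter B.2.1,
          fun y hy z hz => ⟨A.2.2 y hy z hz, B.2.2 y hy z hz⟩⟩,
        Set.inter_subset_inter_left _ Set.inter_subset_left,
        Set.inter_subset_inter_left _ Set.inter_subset_right⟩)
      (fun V => by
        rw [← Set.sdiff_eq, Set.sdiff_nonempty]
        exact fun h => hxU (box_mono R (box_mono S h) V.2.2))
      (fun V => (hcl V).isCompact) hcl
    rw [Set.mem_iInter] at hz
    exact (hz ⟨Set.univ, admissible_univ _, fun _ _ _ _ => trivial⟩).2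
      (hx z fun V hV hxV => (hz ⟨V, hV, hxV⟩).1)
  · exact fun x hx z hz => hz U hU hx

end Helpers

theorem box_le (X : GPSStar.{u}) {U : Set X.carrier} (hU : Admissible X.base U) :
    box (fun x y : X.carrier => x ≤ y) U = U :=
  Set.Subset.antisymm (fun x hx => hx x le_rfl) (fun _ hx _ hxy => hU.2.1 hxy hx)

/-- The identity morphism is the order relation. -/
def GPMorphism.id (X : GPSStar.{u}) : GPMorphism X X where
  rel x y := x ≤ y
  separated x y h := by
    rw [X.le_iff] at h
    push Not at h
    obtain ⟨U, hU, hx, hy⟩ := h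
    exact ⟨U, hU, hy, fun z hz => hU.2.1 hz hx⟩
  admissible_box U hU := (box_le X hU).symm ▸ hU

/-- The composite `S ∗ R` of generalized Priestley morphisms. -/
def GPMorphism.comp {X Y Z : GPSStar.{u}} (R : GPMorphism X Y) (S : GPMorphism Y Z) :
    GPMorphism X Z where
  rel := star Z R.rel S.rel
  separated x z h := by
    unfold star at h
    push Not at h
    obtain ⟨U, hU, hx, hz⟩ := h
    exact ⟨U, hU, hz, fun w hw => hw U hU hx⟩
  admissible_box U hU := by
    rw [box_star R.rel S.rel hU]
    exact R.admissible_box _ (S.admissible_box _ hU)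

theorem GPMorphism.ext_box {X Y : GPSStar.{u}} {R S : GPMorphism X Y}
    (h : ∀ U, Admissible Y.base U → box R.rel U = box S.rel U) : R = S := by
  have aux : ∀ {R S : GPMorphism X Y}, (∀ U, Admissible Y.base U → box R.rel U = box S.rel U) →
      ∀ x y, R.rel x y → S.rel x y := by
    intro R S h x y hxy
    by_contra hn
    obtain ⟨U, hU, hy, hs⟩ := S.separated x y hn
    have : x ∈ box R.rel U := by rw [h U hU]; exact hs
    exact hy (this y hxy)
  ext x y
  exact ⟨aux h x y, aux (fun U hU => (h U hU).symm) x y⟩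

/-- The category of `*`-generalized Priestley spaces and generalized Priestley morphisms. -/
instance GPSStar.category : Category.{u} GPSStar.{u} where
  Hom X Y := GPMorphism X Y
  id X := GPMorphism.id X
  comp R S := GPMorphism.comp R S
  id_comp {X Y} R := GPMorphism.ext_box fun U hU =>
    (box_star _ _ hU).trans (box_le X (R.admissible_box U hU))
  comp_id {X Y} R := GPMorphism.ext_box fun U hU =>
    (box_star _ _ hU).trans (congrArg (box R.rel) (box_le Y hU))
  assoc {W X Y Z} R S T := GPMorphism.ext_box fun U hU => by
    change box (star Z (star Y R.rel S.rel) T.rel) U = box (star Z R.rel (star Z S.rel T.rel)) U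
    rw [box_star (star Y R.rel S.rel) T.rel hU, box_star R.rel S.rel (T.admissible_box U hU),
      box_star R.rel (star Z S.rel T.rel) hU, box_star S.rel T.rel hU]

/-! ## `*`-generalized Esakia spaces -/

/-- A `*`-generalized Esakia space: a `*`-generalized Priestley space in which the downset of each
Esakia clopen set is clopen. -/
structure GESStar : Type (u + 1) extends GPSStar.{u} where
  isClopen_lowerClosure (U : Set carrier) :
    EsakiaClopen base U → IsClopen (lowerClosure U : Set carrier)

/-- A generalized Esakia morphism: a generalized Priestley morphism `R` such that whenever `R x y`
with `y ∈ Y₀`, there is `z ∈ X₀` with `x ≤ z` and `R[z] = ↑y`. -/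
structure GEMorphism (X Y : GESStar.{u}) : Type u extends
    GPMorphism X.toGPSStar Y.toGPSStar where
  lift (x : X.carrier) (y : Y.carrier) : y ∈ Y.base → rel x y →
    ∃ z ∈ X.base, x ≤ z ∧ {w | rel z w} = Set.Ici y

theorem GEMorphism.ext {X Y : GESStar.{u}} {R S : GEMorphism X Y}
    (h : R.toGPMorphism = S.toGPMorphism) : R = S := by
  cases R; cases S; cases h; rfl

/-- The set `[↓(U - V)]ᶜ` (the implication `U → V`) is admissible if `U` and `V` are. -/
theorem GESStar.admissible_himp (X : GESStar.{u}) {U V : Set X.carrier}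
    (hU : Admissible X.base U) (hV : Admissible X.base V) :
    Admissible X.base (lowerClosure (U \ V) : Set X.carrier)ᶜ := by
  have hE : EsakiaClopen X.base (U \ V) :=
    ⟨1, fun _ => U, fun _ => V, fun _ => hU, fun _ => hV,
      (Set.iUnion_const _).symm⟩
  refine ⟨(X.isClopen_lowerClosure _ hE).compl, (lowerClosure (U \ V)).lower.compl, ?_⟩
  intro x hx
  have hx1 : x ∈ (lowerClosure (U \ V) : Set X.carrier) := not_not.1 hx.1
  obtain ⟨a, ha, hxa⟩ := mem_lowerClosure.1 hx1
  have hax : a ≤ x := hx.2 (not_not.2 (subset_lowerClosure ha)) hxa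
  obtain rfl := le_antisymm hxa hax
  refine hV.2.2 ⟨ha.2, fun y hy hay => hx.2 (not_not.2 (subset_lowerClosure ?_)) hay⟩
  exact ⟨hU.2.1 hay ha.1, hy⟩

/-- If `S ∗ R` relates `x` to a point of `U \ V`, then some point above `x` lies in
`box (S ∗ R) U` and not in `box (S ∗ R) V`. -/
theorem exists_mem_box_diff {X Y Z : GESStar.{u}} (R : GEMorphism X Y) (S : GEMorphism Y Z)
    {x : X.carrier} {z : Z.carrier} (hxz : star Z.toGPSStar R.rel S.rel x z)
    {U V : Set Z.carrier} (hU : Admissible Z.base U) (hV : Admissible Z.base V)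
    (hzU : z ∈ U) (hzV : z ∉ V) :
    ∃ w, x ≤ w ∧ w ∈ box R.rel (box S.rel U) ∧ w ∉ box R.rel (box S.rel V) := by
  by_contra hcon
  push Not at hcon
  refine hxz _ (Z.admissible_himp hU hV) ?_ (subset_lowerClosure ⟨hzU, hzV⟩)
  intro y hxy z₁ hyz₁ hz₁
  obtain ⟨z₂, hz₂, h12⟩ := mem_lowerClosure.1 hz₁
  obtain ⟨m, h2m, hm⟩ := exists_maximal_ge hV.1.compl.isClosed hz₂.2
  have hmU : m ∈ U := hU.2.1 h2m hz₂.1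
  have hm0 : m ∈ Z.base := hV.2.2 hm
  have hup : ∀ {A B : GESStar.{u}} (T : GEMorphism A B) {a a' : A.carrier} {b b' : B.carrier},
      a ≤ a' → T.rel a' b → b ≤ b' → T.rel a b' := by
    intro A B T a a' b b' haa hab hbb
    by_contra hn
    obtain ⟨W, hW, hbW, hs⟩ := T.separated a b' hn
    have h1 : a' ∈ box T.rel W := (T.admissible_box W hW).2.1 haa hs
    exact hbW (hW.2.1 hbb (h1 b hab))
  obtain ⟨y', hy'0, hyy', hSy'⟩ := S.lift y m hm0 (hup S le_rfl hyz₁ (h12.trans h2m))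
  obtain ⟨x', -, hxx', hRx'⟩ := R.lift x y' hy'0 (hup R le_rfl hxy hyy')
  have hU' : x' ∈ box R.rel (box S.rel U) := by
    intro y'' hy'' z' hz'
    have h1 : y' ≤ y'' := by
      have : y'' ∈ {w | R.rel x' w} := hy''
      rwa [hRx'] at this
    have h2 : z' ∈ {w | S.rel y' w} := hup S h1 hz' le_rfl
    rw [hSy'] at h2
    exact hU.2.1 h2 hmU
  have h3 : y' ∈ {w | R.rel x' w} := by rw [hRx']; exact le_refl y'
  have h4 : m ∈ {w | S.rel y' w} := by rw [hSy']; exact le_refl m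
  exact hm.1 (hcon x' hxx' hU' y' h3 m h4)

theorem GEMorphism.comp_lift {X Y Z : GESStar.{u}} (R : GEMorphism X Y) (S : GEMorphism Y Z)
    (x : X.carrier) (z : Z.carrier) (hz : z ∈ Z.base)
    (hxz : star Z.toGPSStar R.rel S.rel x z) :
    ∃ w ∈ X.base, x ≤ w ∧ {v | star Z.toGPSStar R.rel S.rel w v} = Set.Ici z := by
  let h : Set Z.carrier → Set X.carrier := fun U => box R.rel (box S.rel U)
  have hadm : ∀ {U}, Admissible Z.base U → Admissible X.base (h U) :=
    fun hU => R.admissible_box _ (S.admissible_box _ hU)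
  have hmono : ∀ {U V}, U ⊆ V → h U ⊆ h V := fun hUV => box_mono _ (box_mono _ hUV)
  obtain ⟨⟨V₀, hV₀⟩, hdir⟩ := (Z.mem_base_iff z).1 hz
  let P := {U : Set Z.carrier // Admissible Z.base U ∧ z ∈ U}
  let Q := {V : Set Z.carrier // V ∈ avoiding Z.base z}
  let C : P × Q → Set X.carrier := fun p => Set.Ici x ∩ h p.1.1 ∩ (h p.2.1)ᶜ
  have : Nonempty (P × Q) := ⟨⟨⟨Set.univ, admissible_univ _, trivial⟩, ⟨V₀, hV₀⟩⟩⟩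
  have hCcl : ∀ p, IsClosed (C p) := fun p =>
    ((isClosed_Ici' x).inter (hadm p.1.2.1).1.isClosed).inter
      (hadm p.2.2.1).1.compl.isClosed
  have hCdir : Directed (· ⊇ ·) C := by
    intro p q
    obtain ⟨V, hV, h1, h2⟩ := hdir p.2.1 p.2.2 q.2.1 q.2.2
    refine ⟨⟨⟨p.1.1 ∩ q.1.1, p.1.2.1.inter q.1.2.1, p.1.2.2, q.1.2.2⟩, ⟨V, hV⟩⟩, ?_, ?_⟩
    · exact fun w hw => ⟨⟨hw.1.1, hmono Set.inter_subset_left hw.1.2⟩,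
        fun hw' => hw.2 (hmono h1 hw')⟩
    · exact fun w hw => ⟨⟨hw.1.1, hmono Set.inter_subset_right hw.1.2⟩,
        fun hw' => hw.2 (hmono h2 hw')⟩
  have hCne : ∀ p, (C p).Nonempty := by
    intro p
    obtain ⟨w, h1, h2, h3⟩ := exists_mem_box_diff R S hxz p.1.2.1 p.2.2.1 p.1.2.2 p.2.2.2
    exact ⟨w, ⟨h1, h2⟩, h3⟩
  obtain ⟨w₀, hw₀⟩ := IsCompact.nonempty_iInter_of_directed_nonempty_isCompact_isClosed C
    hCdir hCne (fun p => (hCcl p).isCompact) hCcl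
  obtain ⟨w, -, hw⟩ := exists_maximal_ge (isClosed_iInter hCcl) hw₀
  have hwC : ∀ p, w ∈ C p := fun p => Set.mem_iInter.1 hw.1 p
  let p₀ : P := ⟨Set.univ, admissible_univ _, trivial⟩
  have hxw : x ≤ w := (hwC (p₀, ⟨V₀, hV₀⟩)).1.1
  have hwU : ∀ U, Admissible Z.base U → z ∈ U → w ∈ h U :=
    fun U hU hzU => (hwC (⟨U, hU, hzU⟩, ⟨V₀, hV₀⟩)).1.2
  have hwV : ∀ V, Admissible Z.base V → z ∉ V → w ∉ h V :=
    fun V hV hzV => (hwC (p₀, ⟨V, hV, hzV⟩)).2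
  refine ⟨w, ?_, hxw, ?_⟩
  · refine (X.mem_base_iff w).2 ⟨⟨h V₀, hadm hV₀.1, hwV V₀ hV₀.1 hV₀.2⟩, ?_⟩
    intro A hA B hB
    -- some `W` containing `w` and some `V` avoiding `z` satisfy `W ∩ (A ∪ B) ⊆ h V`
    let G := {W : Set X.carrier // Admissible X.base W ∧ w ∈ W}
    have : Nonempty (G × Q) := ⟨⟨⟨Set.univ, admissible_univ _, trivial⟩, ⟨V₀, hV₀⟩⟩⟩
    let D : G × Q → Set X.carrier := fun p => (p.1.1 ∩ (h p.2.1)ᶜ) ∩ (A ∪ B)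
    have hDcl : ∀ p, IsClosed (D p) := fun p =>
      (p.1.2.1.1.isClosed.inter (hadm p.2.2.1).1.compl.isClosed).inter
        (hA.1.1.isClosed.union hB.1.1.isClosed)
    have hDdir : Directed (· ⊇ ·) D := by
      intro p q
      obtain ⟨V, hV, h1, h2⟩ := hdir p.2.1 p.2.2 q.2.1 q.2.2
      refine ⟨⟨⟨p.1.1 ∩ q.1.1, p.1.2.1.inter q.1.2.1, p.1.2.2, q.1.2.2⟩, ⟨V, hV⟩⟩, ?_, ?_⟩
      · exact fun v hv => ⟨⟨hv.1.1.1, fun hv' => hv.1.2 (hmono h1 hv')⟩, hv.2⟩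
      · exact fun v hv => ⟨⟨hv.1.1.2, fun hv' => hv.1.2 (hmono h2 hv')⟩, hv.2⟩
    obtain ⟨⟨W, V⟩, hWV⟩ : ∃ p, D p = ∅ := by
      by_contra hne
      push Not at hne
      obtain ⟨v, hv⟩ := IsCompact.nonempty_iInter_of_directed_nonempty_isCompact_isClosed D
        hDdir hne (fun p => (hDcl p).isCompact) hDcl
      rw [Set.mem_iInter] at hv
      have hwv : w ≤ v := (X.le_iff w v).2
        fun W hW hwW => (hv (⟨W, hW, hwW⟩, ⟨V₀, hV₀⟩)).1.1
      have hvC : v ∈ ⋂ p, C p := Set.mem_iInter.2 fun p =>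
        ⟨⟨hxw.trans hwv, (hadm p.1.2.1).2.1 hwv (hwC p).1.2⟩,
          (hv (⟨Set.univ, admissible_univ _, trivial⟩, p.2)).1.2⟩
      have hvw : v = w := le_antisymm (hw.2 hvC hwv) hwv
      have h5 : v ∈ A ∪ B := (hv (⟨Set.univ, admissible_univ _, trivial⟩, ⟨V₀, hV₀⟩)).2
      rw [hvw] at h5
      exact h5.elim hA.2 hB.2
    have hkey : ∀ v ∈ A ∪ B, v ∈ W.1 → v ∈ h V.1 := by
      intro v hv hvW
      by_contra hn
      exact (Set.eq_empty_iff_forall_notMem.1 hWV) v ⟨⟨hvW, hn⟩, hv⟩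
    have hsub : ∀ T, IsUpperSet T → T ⊆ A ∪ B →
        T ⊆ (lowerClosure (W.1 \ h V.1) : Set X.carrier)ᶜ := by
      intro T hT hTs t ht hcl
      obtain ⟨s, hs, hts⟩ := mem_lowerClosure.1 hcl
      exact hs.2 (hkey s (hTs (hT hts ht)) hs.1)
    exact ⟨_, ⟨X.admissible_himp W.2.1 (hadm V.2.1),
        fun hn => hn (subset_lowerClosure ⟨W.2.2, hwV V.1 V.2.1 V.2.2⟩)⟩,
      hsub A hA.1.2.1 Set.subset_union_left, hsub B hB.1.2.1 Set.subset_union_right⟩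
  · ext v
    constructor
    · exact fun hv => (Z.le_iff z v).2 fun U hU hzU => hv U hU (hwU U hU hzU)
    · intro hzv U hU hwU'
      by_contra hvU
      exact hwV U hU (fun hzU => hvU (hU.2.1 hzv hzU)) hwU'

/-- The category of `*`-generalized Esakia spaces and generalized Esakia morphisms, with the same
identities and composition as for `*`-generalized Priestley spaces. -/
instance GESStar.category : Category.{u} GESStar.{u} where
  Hom X Y := GEMorphism X Y
  id X := ⟨GPMorphism.id X.toGPSStar, fun _ y hy hxy => ⟨y, hy, hxy, rfl⟩⟩
  comp R S := ⟨GPMorphism.comp R.toGPMorphism S.toGPMorphism, GEMorphism.comp_lift R S⟩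
  id_comp {X Y} R := GEMorphism.ext
    (GPSStar.category.id_comp (X := X.toGPSStar) (Y := Y.toGPSStar) R.toGPMorphism)
  comp_id {X Y} R := GEMorphism.ext
    (GPSStar.category.comp_id (X := X.toGPSStar) (Y := Y.toGPSStar) R.toGPMorphism)
  assoc {W X Y Z} R S T := GEMorphism.ext
    (GPSStar.category.assoc (W := W.toGPSStar) (X := X.toGPSStar) (Y := Y.toGPSStar)
      (Z := Z.toGPSStar) R.toGPMorphism S.toGPMorphism T.toGPMorphism)

end MeetDuality

namespace MeetDuality

/-! ## The semilattice of admissible clopen upsets -/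

/-! Both dualities come from the functor sending `X` to the semilattice `X^*` and `R` to `box R`,
shown to be faithful, full and essentially surjective. Faithfulness: by the separation axiom, `R` is
determined by `box R` on `Y^*`. Fullness: a homomorphism `h` defines the relation "`x ∈ h V` implies
`y ∈ V`, for all `V`", and compactness gives `box R U = h U` (`box_forall_mem_imp`). Essential
surjectivity: prime filters of a distributive `L` separate points from filters
(`IsMeetFilter.exists_prime`). Their closure in `L → Bool` is a Priestley space of filters whose
admissible clopen upsets are exactly the sets `basicUpset a` (`admissible_basicUpset`,
`exists_eq_basicUpset`), so `L` is recovered. In the Esakia case `X^*` has the implication `[↓(U \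
V)]ᶜ`. The lifting condition makes `box R` preserve it; conversely, a homomorphism preserving
implication yields lifts as maximal points of a suitable closed set (`GPMorphism.ofHom_lift`). -/

/-- The form of compactness used throughout: when no member of a down-directed closed family proves
a claim, a single point witnesses all the failures at once. -/
theorem exists_mem_forall_mem {X : Type u} [TopologicalSpace X] [CompactSpace X]
    {𝒱 : Set (Set X)} (hne : 𝒱.Nonempty) (hcl : ∀ V ∈ 𝒱, IsClosed V)
    (hdir : DirectedOn (· ⊇ ·) 𝒱) {K : Set X} (hK : IsClosed K)
    (h : ∀ V ∈ 𝒱, ¬ V ⊆ Kᶜ) : ∃ x ∈ K, ∀ V ∈ 𝒱, x ∈ V := by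
  have : Nonempty 𝒱 := hne.to_subtype
  have hcl' : ∀ V : 𝒱, IsClosed ((V : Set X) ∩ K) := fun V => (hcl V V.2).inter hK
  obtain ⟨x, hx⟩ := IsCompact.nonempty_iInter_of_directed_nonempty_isCompact_isClosed
    (fun V : 𝒱 => (V : Set X) ∩ K)
    (fun A B => by
      obtain ⟨V, hV, hA, hB⟩ := hdir A A.2 B B.2
      exact ⟨⟨V, hV⟩, Set.inter_subset_inter_left _ hA, Set.inter_subset_inter_left _ hB⟩)
    (fun V => by
      obtain ⟨x, hxV, hxK⟩ := Set.not_subset.1 (h V V.2)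
      exact ⟨x, hxV, not_not.1 hxK⟩)
    (fun V => (hcl' V).isCompact) hcl'
  rw [Set.mem_iInter] at hx
  exact ⟨x, (hx ⟨_, hne.some_mem⟩).2, fun V hV => (hx ⟨V, hV⟩).1⟩

/-- The admissible clopen upsets of a `*`-generalized Priestley space, ordered by inclusion. -/
abbrev AdmissibleUpset (X : GPSStar.{u}) : Type u :=
  {U : Set X.carrier // Admissible X.base U}

instance (X : GPSStar.{u}) : SemilatticeInf (AdmissibleUpset X) :=
  Subtype.semilatticeInf fun _ _ hU hV => hU.inter hV

instance (X : GPSStar.{u}) : OrderTop (AdmissibleUpset X) where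
  top := ⟨Set.univ, admissible_univ _⟩
  le_top _ := Set.subset_univ _

theorem GPSStar.exists_admissible_notMem (X : GPSStar.{u}) {x : X.carrier} (hx : x ∈ X.base)
    {U V : Set X.carrier} (hU : Admissible X.base U) (hV : Admissible X.base V)
    (hxU : x ∉ U) (hxV : x ∉ V) :
    ∃ W, Admissible X.base W ∧ x ∉ W ∧ U ⊆ W ∧ V ⊆ W := by
  obtain ⟨W, hW, h⟩ := ((X.mem_base_iff x).1 hx).2 U ⟨hU, hxU⟩ V ⟨hV, hxV⟩
  exact ⟨W, hW.1, hW.2, h⟩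

/-- It suffices to find `V₁ ⊇ U₁ ∪ W` and `V₂ ⊇ U₂ ∪ W` with `V₁ ∩ V₂ ⊆ W`. Otherwise compactness
gives a point outside `W` in all such intersections; a maximal point of `Wᶜ` above it lies in `X₀`,
where directedness produces a contradicting `V`. -/
theorem isDistributiveMeet_admissibleUpset (X : GPSStar.{u}) :
    IsDistributiveMeet (AdmissibleUpset X) := by
  intro W U₁ U₂ hle
  let 𝒱 : Set (Set X.carrier) := {V | ∃ V₁ V₂ : AdmissibleUpset X,
    (U₁ ≤ V₁ ∧ W ≤ V₁) ∧ (U₂ ≤ V₂ ∧ W ≤ V₂) ∧ V = V₁.1 ∩ V₂.1}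
  by_contra hcon
  obtain ⟨x, hxW, hx⟩ := exists_mem_forall_mem (𝒱 := 𝒱)
    ⟨_, ⊤, ⊤, ⟨le_top, le_top⟩, ⟨le_top, le_top⟩, rfl⟩
    (by
      rintro _ ⟨V₁, V₂, -, -, rfl⟩
      exact V₁.2.1.isClosed.inter V₂.2.1.isClosed)
    (by
      rintro _ ⟨V₁, V₂, h₁, h₂, rfl⟩ _ ⟨V₁', V₂', h₁', h₂', rfl⟩
      exact ⟨_, ⟨V₁ ⊓ V₁', V₂ ⊓ V₂', ⟨le_inf h₁.1 h₁'.1, le_inf h₁.2 h₁'.2⟩,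
        ⟨le_inf h₂.1 h₂'.1, le_inf h₂.2 h₂'.2⟩, rfl⟩,
        Set.inter_subset_inter Set.inter_subset_left Set.inter_subset_left,
        Set.inter_subset_inter Set.inter_subset_right Set.inter_subset_right⟩)
    W.2.1.compl.isClosed
    (by
      rintro _ ⟨V₁, V₂, h₁, h₂, rfl⟩ hV
      rw [compl_compl] at hV
      exact hcon ⟨V₁, V₂, h₁.1, h₂.1, le_antisymm (le_inf h₁.2 h₂.2) hV⟩)
  obtain ⟨m, hxm, hm⟩ := exists_maximal_ge W.2.1.compl.isClosed hxW
  have hm0 : m ∈ X.base := W.2.2.2 hm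
  -- Since `m` misses some `Uᵢ`, one upset containing `Uᵢ ∪ W` also misses `m`; it is paired with
  -- `⊤` on the other side.
  by_cases h1 : m ∈ U₁.1
  · have h2 : m ∉ U₂.1 := fun h2 => hm.1 (hle ⟨h1, h2⟩)
    obtain ⟨V, hV, hmV, hU, hW⟩ := X.exists_admissible_notMem hm0 U₂.2 W.2 h2 hm.1
    exact hmV (hV.2.1 hxm (hx _ ⟨⊤, ⟨V, hV⟩, ⟨le_top, le_top⟩, ⟨hU, hW⟩, rfl⟩).2)
  · obtain ⟨V, hV, hmV, hU, hW⟩ := X.exists_admissible_notMem hm0 U₁.2 W.2 h1 hm.1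
    exact hmV (hV.2.1 hxm (hx _ ⟨⟨V, hV⟩, ⊤, ⟨hU, hW⟩, ⟨le_top, le_top⟩, rfl⟩).1)

/-! ### Homomorphisms versus relations -/

/-- The homomorphism of semilattices of admissible clopen upsets given by `box`. -/
def GPMorphism.boxHom {X Y : GPSStar.{u}} (R : GPMorphism X Y) :
    InfTopHom (AdmissibleUpset Y) (AdmissibleUpset X) where
  toFun U := ⟨box R.rel U.1, R.admissible_box U.1 U.2⟩
  map_inf' _ _ := Subtype.ext <| Set.ext fun _ =>
    ⟨fun h => ⟨fun y hy => (h y hy).1, fun y hy => (h y hy).2⟩,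
      fun h y hy => ⟨h.1 y hy, h.2 y hy⟩⟩
  map_top' := Subtype.ext <| Set.eq_univ_of_forall fun _ _ _ => trivial

theorem GPMorphism.boxHom_injective {X Y : GPSStar.{u}} :
    Function.Injective (GPMorphism.boxHom (X := X) (Y := Y)) := fun _ _ h => by
  refine GPMorphism.ext_box fun U hU => ?_
  have hU' := DFunLike.congr_fun h (⟨U, hU⟩ : AdmissibleUpset Y)
  exact congrArg Subtype.val hU'

/-- The upsets `V` with `x ∈ h V` form a filter. If `x ∉ h U`, none of them is contained in `U`, so
by compactness they share a point `y ∉ U`, and `y` is related to `x`. -/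
theorem box_forall_mem_imp {X Y : GPSStar.{u}}
    (h : InfTopHom (AdmissibleUpset Y) (AdmissibleUpset X)) (U : AdmissibleUpset Y) :
    box (fun x y => ∀ V : AdmissibleUpset Y, x ∈ (h V).1 → y ∈ V.1) U.1 = (h U).1 := by
  refine Set.Subset.antisymm (fun x hx => ?_) fun x hx y hy => hy U hx
  by_contra hxU
  obtain ⟨y, hyU, hy⟩ := exists_mem_forall_mem
    (𝒱 := {V | ∃ V' : AdmissibleUpset Y, x ∈ (h V').1 ∧ V = V'.1})
    ⟨_, ⊤, by rw [map_top]; trivial, rfl⟩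
    (by rintro _ ⟨V, -, rfl⟩; exact V.2.1.isClosed)
    (by
      rintro _ ⟨V, hV, rfl⟩ _ ⟨V', hV', rfl⟩
      exact ⟨_, ⟨V ⊓ V', by rw [map_inf]; exact ⟨hV, hV'⟩, rfl⟩,
        Set.inter_subset_left, Set.inter_subset_right⟩)
    U.2.1.compl.isClosed
    (by
      rintro _ ⟨V, hV, rfl⟩ hVU
      rw [compl_compl] at hVU
      exact hxU (OrderHomClass.mono h (show V ≤ U from hVU) hV))
  exact hyU (hx y fun V hV => hy _ ⟨V, hV, rfl⟩)

/-- The generalized Priestley morphism induced by a homomorphism of the semilattices of admissible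
clopen upsets. -/
def GPMorphism.ofHom {X Y : GPSStar.{u}}
    (h : InfTopHom (AdmissibleUpset Y) (AdmissibleUpset X)) : GPMorphism X Y where
  rel x y := ∀ V : AdmissibleUpset Y, x ∈ (h V).1 → y ∈ V.1
  separated x y hxy := by
    push Not at hxy
    obtain ⟨V, hx, hy⟩ := hxy
    exact ⟨V.1, V.2, hy, fun z hz => hz V hx⟩
  admissible_box U hU := by
    rw [box_forall_mem_imp h ⟨U, hU⟩]
    exact (h ⟨U, hU⟩).2

theorem GPMorphism.boxHom_ofHom {X Y : GPSStar.{u}}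
    (h : InfTopHom (AdmissibleUpset Y) (AdmissibleUpset X)) : (ofHom h).boxHom = h :=
  InfTopHom.ext fun U => Subtype.ext (box_forall_mem_imp h U)

/-- The semilattice of admissible clopen upsets as an object of `DM`. -/
abbrev GPSStar.toDM (X : GPSStar.{u}) : DM.{u} :=
  ⟨SemilatInfCat.of (AdmissibleUpset X), isDistributiveMeet_admissibleUpset X⟩

/-- The morphism of `DM` given by `box`. -/
def GPMorphism.toDMHom {X Y : GPSStar.{u}} (R : GPMorphism X Y) : Y.toDM ⟶ X.toDM :=
  ObjectProperty.homMk R.boxHom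

/-- The contravariant functor taking a `*`-generalized Priestley space to its semilattice of
admissible clopen upsets. -/
def admissibleFunctor : GPSStar.{u} ⥤ DM.{u}ᵒᵖ where
  obj X := Opposite.op X.toDM
  map R := (GPMorphism.toDMHom R).op
  map_id X := Quiver.Hom.unop_inj <| ObjectProperty.hom_ext _ <|
    InfTopHom.ext fun U => Subtype.ext (box_le X U.2)
  map_comp R S := Quiver.Hom.unop_inj <| ObjectProperty.hom_ext _ <|
    InfTopHom.ext fun U => Subtype.ext (box_star R.rel S.rel U.2)

instance : admissibleFunctor.{u}.Faithful where
  map_injective h := GPMorphism.boxHom_injective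
    (congrArg InducedCategory.Hom.hom (congrArg Quiver.Hom.unop h))

instance : admissibleFunctor.{u}.Full where
  map_surjective f := ⟨GPMorphism.ofHom f.unop.hom, Quiver.Hom.unop_inj <|
    ObjectProperty.hom_ext _ <| GPMorphism.boxHom_ofHom f.unop.hom⟩

/-! ## Prime filters -/

/-- A filter of a meet semilattice with top: an upset containing the top and closed under
binary meets. -/
structure IsMeetFilter {L : Type u} [SemilatticeInf L] [OrderTop L] (F : Set L) : Prop where
  top_mem : ⊤ ∈ F
  mem_of_le {a b : L} : a ≤ b → a ∈ F → b ∈ F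
  inf_mem {a b : L} : a ∈ F → b ∈ F → a ⊓ b ∈ F

/-- A prime filter: a proper filter whose complement is directed. -/
structure IsPrimeFilter {L : Type u} [SemilatticeInf L] [OrderTop L] (F : Set L) : Prop
    extends IsMeetFilter F where
  compl_nonempty : Fᶜ.Nonempty
  compl_directed : DirectedOn (· ≤ ·) Fᶜ

section Filters

variable {L : Type u} [SemilatticeInf L] [OrderTop L]

theorem isMeetFilter_Ici (a : L) : IsMeetFilter (Set.Ici a) :=
  ⟨le_top, fun h h' => le_trans h' h, fun h h' => le_inf h h'⟩

theorem IsMeetFilter.adjoin {F : Set L} (hF : IsMeetFilter F) (c : L) :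
    IsMeetFilter {d | ∃ f ∈ F, f ⊓ c ≤ d} where
  top_mem := ⟨⊤, hF.top_mem, le_top⟩
  mem_of_le := fun h ⟨f, hf, hd⟩ => ⟨f, hf, hd.trans h⟩
  inf_mem := fun ⟨f, hf, hd⟩ ⟨g, hg, he⟩ => ⟨f ⊓ g, hF.inf_mem hf hg,
    le_inf ((inf_le_inf_right _ inf_le_left).trans hd)
      ((inf_le_inf_right _ inf_le_right).trans he)⟩

/-- In a distributive meet semilattice every filter is the intersection of the prime filters that
contain it. -/
theorem IsMeetFilter.exists_prime (hL : IsDistributiveMeet L) {F : Set L} (hF : IsMeetFilter F)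
    {i : L} (hi : i ∉ F) : ∃ P, IsPrimeFilter P ∧ F ⊆ P ∧ i ∉ P := by
  obtain ⟨P, hFP, hP⟩ := zorn_subset_nonempty {G : Set L | IsMeetFilter G ∧ i ∉ G}
    (fun c hc hchain hne => by
      refine ⟨⋃₀ c, ⟨⟨?_, ?_, ?_⟩, ?_⟩, fun s hs => Set.subset_sUnion_of_mem hs⟩
      · exact ⟨hne.some, hne.some_mem, (hc hne.some_mem).1.top_mem⟩
      · rintro a b hab ⟨G, hG, ha⟩
        exact ⟨G, hG, (hc hG).1.mem_of_le hab ha⟩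
      · rintro a b ⟨G, hG, ha⟩ ⟨H, hH, hb⟩
        rcases hchain.total hG hH with h | h
        · exact ⟨H, hH, (hc hH).1.inf_mem (h ha) hb⟩
        · exact ⟨G, hG, (hc hG).1.inf_mem ha (h hb)⟩
      · rintro ⟨G, hG, ha⟩
        exact (hc hG).2 ha) F ⟨hF, hi⟩
  have hPF : IsMeetFilter P := hP.1.1
  -- Maximality: adjoining any `c ∉ P` to `P` brings in `i`.
  have key : ∀ c ∉ P, ∃ f ∈ P, f ⊓ c ≤ i := by
    intro c hc
    by_contra hcon
    exact hc (hP.2 ⟨hPF.adjoin c, hcon⟩ (fun f hf => ⟨f, hf, inf_le_left⟩)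
      ⟨⊤, hPF.top_mem, inf_le_right⟩)
  refine ⟨P, ⟨hPF, ⟨i, hP.1.2⟩, ?_⟩, hFP, hP.1.2⟩
  intro a ha b hb
  obtain ⟨f, hf, hfa⟩ := key a ha
  obtain ⟨g, hg, hgb⟩ := key b hb
  -- Distributivity is applied twice, first to `i` and then to the factor `a₁`, giving `i = f₁ ⊓ (g₁
  -- ⊓ c)` with `f₁, g₁ ∈ P`. Then `c` bounds both `a` and `b`, and `c ∈ P` would force `i ∈ P`.
  obtain ⟨f₁, a₁, hf₁, ha₁, hi₁⟩ := hL i f a hfa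
  obtain ⟨g₁, c, hg₁, hc, hac⟩ := hL a₁ g b (hgb.trans (hi₁.le.trans inf_le_right))
  refine ⟨c, fun hcP => hP.1.2 ?_, ha₁.trans (hac.le.trans inf_le_right), hc⟩
  rw [hi₁, hac]
  exact hPF.inf_mem (hPF.mem_of_le hf₁ hf) (hPF.inf_mem (hPF.mem_of_le hg₁ hg) hcP)

end Filters

/-! ## The dual space of a distributive meet semilattice -/

/-- The characteristic functions of prime filters. -/
def primePoints (L : Type u) [SemilatticeInf L] [OrderTop L] : Set (L → Bool) :=
  {x | IsPrimeFilter {a | x a = true}}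

/-- The points of the dual space: the closure of the set of prime filters in `L → Bool`. -/
abbrev DualSpace (L : Type u) [SemilatticeInf L] [OrderTop L] : Type u :=
  closure (primePoints L)

section DualSpace

variable {L : Type u} [SemilatticeInf L] [OrderTop L]

theorem isClopen_setOf_apply {L : Type u} (a : L) : IsClopen {x : L → Bool | x a = true} :=
  (isClopen_discrete {true}).preimage (continuous_apply a)

/-- Each filter condition involves finitely many coordinates, so limits of prime filters are still
filters. Primeness asserts the existence of elements outside the filter and need not survive. -/
theorem isClosed_isMeetFilter : IsClosed {x : L → Bool | IsMeetFilter {a | x a = true}} := by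
  have h : {x : L → Bool | IsMeetFilter {a | x a = true}} =
      {x | x ⊤ = true} ∩ {x | ∀ a b, a ≤ b → x a = true → x b = true} ∩
        {x | ∀ a b, x a = true → x b = true → x (a ⊓ b) = true} :=
    Set.ext fun x => ⟨fun h => ⟨⟨h.1, fun _ _ => h.2⟩, fun _ _ => h.3⟩,
      fun h => ⟨h.1.1, h.1.2 _ _, h.2 _ _⟩⟩
  rw [h]
  refine ((isClopen_setOf_apply ⊤).isClosed.inter ?_).inter ?_
  · simp only [Set.ofPred_forall]
    exact isClosed_iInter fun a => isClosed_iInter fun b => isClosed_iInter fun _ =>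
      isClosed_imp (isClopen_setOf_apply a).isOpen (isClopen_setOf_apply b).isClosed
  · simp only [Set.ofPred_forall]
    exact isClosed_iInter fun a => isClosed_iInter fun b =>
      isClosed_imp (isClopen_setOf_apply a).isOpen <|
        isClosed_imp (isClopen_setOf_apply b).isOpen (isClopen_setOf_apply (a ⊓ b)).isClosed

theorem DualSpace.isMeetFilter (x : DualSpace L) : IsMeetFilter {a | x.1 a = true} :=
  closure_minimal (fun _ hx => IsPrimeFilter.toIsMeetFilter hx) isClosed_isMeetFilter x.2

instance : CompactSpace (DualSpace L) :=
  isCompact_iff_compactSpace.1 isClosed_closure.isCompact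

/-- The points of the dual space given by prime filters. -/
def dualBase (L : Type u) [SemilatticeInf L] [OrderTop L] : Set (DualSpace L) :=
  {x | x.1 ∈ primePoints L}

/-- The set of points of the dual space that contain `a`. -/
def basicUpset (a : L) : Set (DualSpace L) :=
  {x | x.1 a = true}

theorem isClopen_basicUpset (a : L) : IsClopen (basicUpset a) :=
  (isClopen_setOf_apply a).preimage continuous_subtype_val

theorem DualSpace.le_iff {x y : DualSpace L} :
    x ≤ y ↔ ∀ a, x ∈ basicUpset a → y ∈ basicUpset a :=
  forall_congr' fun _ => Bool.le_iff_imp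

theorem isUpperSet_basicUpset (a : L) : IsUpperSet (basicUpset a) :=
  fun _ _ h => DualSpace.le_iff.1 h a

instance : PriestleySpace (DualSpace L) where
  priestley {x y} h := by
    rw [DualSpace.le_iff] at h
    push Not at h
    obtain ⟨a, hx, hy⟩ := h
    exact ⟨_, isClopen_basicUpset a, isUpperSet_basicUpset a, hx, hy⟩

theorem dense_dualBase : Dense (dualBase L) :=
  Subtype.dense_iff.2 fun _ hx => by
    refine closure_mono (fun y hy => ?_) hx
    exact ⟨⟨y, subset_closure hy⟩, hy, rfl⟩

theorem basicUpset_mono {a b : L} (h : a ≤ b) : basicUpset a ⊆ basicUpset b :=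
  fun x => x.isMeetFilter.mem_of_le h

theorem IsMeetFilter.exists_dualBase (hL : IsDistributiveMeet L) {F : Set L}
    (hF : IsMeetFilter F) {i : L} (hi : i ∉ F) :
    ∃ x ∈ dualBase L, (∀ a ∈ F, x ∈ basicUpset a) ∧ x ∉ basicUpset i := by
  classical
  obtain ⟨P, hP, hFP, hiP⟩ := hF.exists_prime hL hi
  have hx : (fun a => decide (a ∈ P)) ∈ primePoints L := by simpa [primePoints] using hP
  exact ⟨⟨_, subset_closure hx⟩, hx, fun a ha => decide_eq_true (hFP ha),
    fun h => hiP (of_decide_eq_true h)⟩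

theorem basicUpset_subset_iff (hL : IsDistributiveMeet L) {a b : L} :
    basicUpset a ⊆ basicUpset b ↔ a ≤ b := by
  refine ⟨fun h => ?_, basicUpset_mono⟩
  by_contra hab
  obtain ⟨x, -, hx, hxb⟩ := (isMeetFilter_Ici a).exists_dualBase hL hab
  exact hxb (h (hx a le_rfl))

/-- A filter missing `a` extends to a prime filter missing `a`, so a maximal point outside
`basicUpset a` is already prime. -/
theorem admissible_basicUpset (hL : IsDistributiveMeet L) (a : L) :
    Admissible (dualBase L) (basicUpset a) := by
  refine ⟨isClopen_basicUpset a, isUpperSet_basicUpset a, fun x hx => ?_⟩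
  obtain ⟨y, hy, hxy, hya⟩ := x.isMeetFilter.exists_dualBase hL hx.1
  have hle : x ≤ y := DualSpace.le_iff.2 hxy
  rwa [le_antisymm hle (hx.2 hya hle)]

/-- No point of `U` lies below `m`, so the sets `basicUpset a` with `a` outside `m` cover `U`.
Primeness of `m` makes this cover directed, and by compactness one member suffices. -/
theorem exists_basicUpset_of_mem_dualBase {U : Set (DualSpace L)} (hU : IsClopen U)
    (hU' : IsUpperSet U) {m : DualSpace L} (hm : m ∈ dualBase L) (hmU : m ∉ U) :
    ∃ c, U ⊆ basicUpset c ∧ m ∉ basicUpset c := by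
  have hP : IsPrimeFilter {a | m.1 a = true} := hm
  have : Nonempty ({a | m.1 a = true}ᶜ : Set L) := hP.compl_nonempty.to_subtype
  obtain ⟨c, hc⟩ := hU.isClosed.isCompact.elim_directed_cover
    (fun a : ({a | m.1 a = true}ᶜ : Set L) => basicUpset a.1)
    (fun a => (isClopen_basicUpset a.1).isOpen)
    (fun u hu => by
      have hum : ¬ u ≤ m := fun h => hmU (hU' h hu)
      rw [DualSpace.le_iff] at hum
      push Not at hum
      obtain ⟨a, hua, hma⟩ := hum
      exact Set.mem_iUnion.2 ⟨⟨a, hma⟩, hua⟩)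
    (fun a b => by
      obtain ⟨c, hc, hac, hbc⟩ := hP.compl_directed a a.2 b b.2
      exact ⟨⟨c, hc⟩, basicUpset_mono hac, basicUpset_mono hbc⟩)
  exact ⟨c.1, hc, c.2⟩

/-- If no basic upset equals `U`, compactness gives a point outside `U` in every basic upset
containing `U`. A maximal such point of `Uᶜ` above it is prime by admissibility, yet some basic
upset containing `U` omits it. -/
theorem exists_eq_basicUpset {U : Set (DualSpace L)} (hU : Admissible (dualBase L) U) :
    ∃ a, U = basicUpset a := by
  by_contra hcon
  obtain ⟨x, hxU, hx⟩ := exists_mem_forall_mem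
    (𝒱 := {V | ∃ c : L, U ⊆ basicUpset c ∧ V = basicUpset c})
    ⟨_, ⊤, fun x _ => x.isMeetFilter.top_mem, rfl⟩
    (by rintro _ ⟨c, -, rfl⟩; exact (isClopen_basicUpset c).isClosed)
    (by
      rintro _ ⟨c, hc, rfl⟩ _ ⟨d, hd, rfl⟩
      exact ⟨_, ⟨c ⊓ d, fun x hx => x.isMeetFilter.inf_mem (hc hx) (hd hx), rfl⟩,
        basicUpset_mono inf_le_left, basicUpset_mono inf_le_right⟩)
    hU.1.compl.isClosed
    (by
      rintro _ ⟨c, hc, rfl⟩ hcU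
      rw [compl_compl] at hcU
      exact hcon ⟨c, hc.antisymm hcU⟩)
  obtain ⟨m, hxm, hm⟩ := exists_maximal_ge hU.1.compl.isClosed hxU
  obtain ⟨c, hUc, hmc⟩ := exists_basicUpset_of_mem_dualBase hU.1 hU.2.1 (hU.2.2 hm) hm.1
  exact hmc (isUpperSet_basicUpset c hxm (hx _ ⟨c, hUc, rfl⟩))

/-- Admissible upsets being basic, `avoiding (dualBase L) x` is an order-isomorphic copy of the
complement of the filter `x`, so both sides express primeness. -/
theorem mem_dualBase_iff (hL : IsDistributiveMeet L) (x : DualSpace L) :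
    x ∈ dualBase L ↔ (avoiding (dualBase L) x).Nonempty ∧
      DirectedOn (· ⊆ ·) (avoiding (dualBase L) x) := by
  constructor
  · intro hx
    have hP : IsPrimeFilter {a | x.1 a = true} := hx
    refine ⟨?_, ?_⟩
    · obtain ⟨a, ha⟩ := hP.compl_nonempty
      exact ⟨_, admissible_basicUpset hL a, ha⟩
    · rintro _ ⟨hU, hxU⟩ _ ⟨hV, hxV⟩
      obtain ⟨a, rfl⟩ := exists_eq_basicUpset hU
      obtain ⟨b, rfl⟩ := exists_eq_basicUpset hV
      obtain ⟨c, hc, hac, hbc⟩ := hP.compl_directed a hxU b hxV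
      exact ⟨_, ⟨admissible_basicUpset hL c, hc⟩, basicUpset_mono hac, basicUpset_mono hbc⟩
  · rintro ⟨⟨U, hU, hxU⟩, hdir⟩
    refine ⟨x.isMeetFilter, ?_, ?_⟩
    · obtain ⟨a, rfl⟩ := exists_eq_basicUpset hU
      exact ⟨a, hxU⟩
    · intro a ha b hb
      obtain ⟨W, ⟨hW, hxW⟩, haW, hbW⟩ := hdir _ ⟨admissible_basicUpset hL a, ha⟩
        _ ⟨admissible_basicUpset hL b, hb⟩
      obtain ⟨c, rfl⟩ := exists_eq_basicUpset hW
      exact ⟨c, hxW, (basicUpset_subset_iff hL).1 haW, (basicUpset_subset_iff hL).1 hbW⟩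

variable (L) in
/-- The dual `*`-generalized Priestley space of a distributive meet semilattice. -/
def dualGPSStar (hL : IsDistributiveMeet L) : GPSStar.{u} where
  carrier := DualSpace L
  base := dualBase L
  dense_base := dense_dualBase
  mem_base_iff := mem_dualBase_iff hL
  le_iff x y := by
    rw [DualSpace.le_iff]
    refine ⟨fun h U hU => ?_, fun h a => h _ (admissible_basicUpset hL a)⟩
    obtain ⟨a, rfl⟩ := exists_eq_basicUpset hU
    exact h a

/-- A distributive meet semilattice is isomorphic to the semilattice of admissible clopen upsets of
its dual space. -/
noncomputable def dualOrderIso (hL : IsDistributiveMeet L) :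
    L ≃o AdmissibleUpset (dualGPSStar L hL) :=
  RelIso.ofSurjective (OrderEmbedding.ofMapLEIff
    (fun a => (⟨basicUpset a, admissible_basicUpset hL a⟩ : AdmissibleUpset (dualGPSStar L hL)))
    fun _ _ => basicUpset_subset_iff hL) fun U => by
      obtain ⟨a, ha⟩ := exists_eq_basicUpset U.2
      exact ⟨a, Subtype.ext ha.symm⟩

end DualSpace

instance : admissibleFunctor.{u}.EssSurj where
  mem_essImage L := ⟨dualGPSStar L.unop.obj L.unop.property,
    ⟨(ObjectProperty.isoMk _ (SemilatInfCat.Iso.mk (dualOrderIso L.unop.property))).op⟩⟩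

/-! ## Implicative meet semilattices and Esakia spaces -/

theorem le_himp_iff_inf_le {L : Type u} [ImplicativeSemilattice L] {a b c : L} :
    a ≤ b ⇨ c ↔ a ⊓ b ≤ c :=
  ImplicativeSemilattice.le_himp_iff a b c

theorem himp_inf_self_le {L : Type u} [ImplicativeSemilattice L] (b c : L) :
    (b ⇨ c) ⊓ b ≤ c :=
  le_himp_iff_inf_le.1 le_rfl

theorem isDistributiveMeet_of_implicative (L : Type u) [ImplicativeSemilattice L] :
    IsDistributiveMeet L := by
  intro a b₁ b₂ h
  -- The hypothesis says `b₂ ≤ b₁ ⇨ a`; modus ponens gives both `b₁ ≤ (b₁ ⇨ a) ⇨ a` and that the two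
  -- factors meet below `a`.
  refine ⟨(b₁ ⇨ a) ⇨ a, b₁ ⇨ a, ?_, ?_, ?_⟩
  · rw [le_himp_iff_inf_le, inf_comm]
    exact himp_inf_self_le b₁ a
  · rwa [le_himp_iff_inf_le, inf_comm]
  · refine le_antisymm (le_inf ?_ ?_) (himp_inf_self_le _ _)
    · exact le_himp_iff_inf_le.2 inf_le_left
    · exact le_himp_iff_inf_le.2 inf_le_left

instance (X : GESStar.{u}) : ImplicativeSemilattice (AdmissibleUpset X.toGPSStar) where
  himp U V := ⟨_, X.admissible_himp U.2 V.2⟩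
  le_himp_iff U V W := by
    constructor
    · intro h x hx
      by_contra hxW
      exact h hx.1 (subset_lowerClosure ⟨hx.2, hxW⟩)
    · intro h x hx hx'
      obtain ⟨y, hy, hxy⟩ := mem_lowerClosure.1 hx'
      exact hy.2 (h ⟨U.2.2.1 hxy hx, hy.1⟩)

theorem GESStar.notMem_himp_iff {X : GESStar.{u}} {U V : AdmissibleUpset X.toGPSStar}
    {x : X.carrier} : x ∉ (U ⇨ V).1 ↔ ∃ y, x ≤ y ∧ y ∈ U.1 ∧ y ∉ V.1 := by
  refine not_not.trans (mem_lowerClosure.trans (exists_congr fun y => ?_))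
  exact ⟨fun h => ⟨h.2, h.1⟩, fun h => ⟨h.2, h.1⟩⟩

theorem GPMorphism.rel_of_le {X Y : GPSStar.{u}} (R : GPMorphism X Y) {x : X.carrier}
    {y y' : Y.carrier} (hxy : R.rel x y) (hy : y ≤ y') : R.rel x y' := by
  by_contra hn
  obtain ⟨W, hW, hyW, hs⟩ := R.separated x y' hn
  exact hyW (hW.2.1 hy (hs hxy))

/-- The homomorphism of implicative meet semilattices of admissible clopen upsets given by
`box`. -/
def GEMorphism.boxHom {X Y : GESStar.{u}} (R : GEMorphism X Y) :
    ImplicativeHom (AdmissibleUpset Y.toGPSStar) (AdmissibleUpset X.toGPSStar) where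
  toInfHom := R.toGPMorphism.boxHom.toInfHom
  map_himp' U V := by
    have hmap : ∀ W W', R.toGPMorphism.boxHom (W ⊓ W') =
      R.toGPMorphism.boxHom W ⊓ R.toGPMorphism.boxHom W' := map_inf R.toGPMorphism.boxHom
    change R.toGPMorphism.boxHom (U ⇨ V) = R.toGPMorphism.boxHom U ⇨ R.toGPMorphism.boxHom V
    refine le_antisymm ?_ fun x hx y hxy => ?_
    · rw [le_himp_iff_inf_le, ← hmap]
      exact OrderHomClass.mono R.toGPMorphism.boxHom (himp_inf_self_le U V)
    · by_contra hy
      obtain ⟨z, hyz, hzU, hzV⟩ := GESStar.notMem_himp_iff.1 hy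
      -- Passing to a maximal point of `Vᶜ` lands in `Y₀`, where lifting applies. The lift `w` has
      -- `R[w] = ↑m`, so it lies in `box R U` but not in `box R V`.
      obtain ⟨m, hzm, hm⟩ := exists_maximal_ge V.2.1.compl.isClosed hzV
      obtain ⟨w, -, hxw, hw⟩ := R.lift x m (V.2.2.2 hm)
        (R.toGPMorphism.rel_of_le hxy (hyz.trans hzm))
      have hwm : ∀ v, R.rel w v ↔ m ≤ v := fun v => Set.ext_iff.1 hw v
      refine GESStar.notMem_himp_iff.2 ⟨w, hxw, fun v hv => ?_, fun h => ?_⟩ hx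
      · exact U.2.2.1 (hzm.trans ((hwm v).1 hv)) hzU
      · exact hm.1 (h m ((hwm m).2 le_rfl))

theorem ImplicativeHom.map_top {L K : Type u} [ImplicativeSemilattice L]
    [ImplicativeSemilattice K] (f : ImplicativeHom L K) : f.toFun ⊤ = ⊤ := by
  have h : ∀ {M : Type u} [ImplicativeSemilattice M] (a : M), a ⇨ a = ⊤ := fun a =>
    top_le_iff.1 (le_himp_iff_inf_le.2 inf_le_right)
  rw [← h ⊤, f.map_himp', h]

/-- A homomorphism of implicative meet semilattices as a map preserving finite meets. -/
def ImplicativeHom.toInfTopHom {L K : Type u} [ImplicativeSemilattice L]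
    [ImplicativeSemilattice K] (f : ImplicativeHom L K) : InfTopHom L K where
  toInfHom := f.toInfHom
  map_top' := f.map_top

/-- The lift must lie in `h U` exactly when `y ∈ U`. Points with this property form a closed set
`C`; preservation of implication and compactness give one above `x`. A maximal point of `C` above it
is then shown to lie in `X₀`. -/
theorem GPMorphism.ofHom_lift {X Y : GESStar.{u}}
    (f : ImplicativeHom (AdmissibleUpset Y.toGPSStar) (AdmissibleUpset X.toGPSStar))
    (x : X.carrier) (y : Y.carrier) (hy : y ∈ Y.base)
    (hxy : (GPMorphism.ofHom f.toInfTopHom).rel x y) :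
    ∃ z ∈ X.base, x ≤ z ∧ {w | (GPMorphism.ofHom f.toInfTopHom).rel z w} = Set.Ici y := by
  let h : InfTopHom (AdmissibleUpset Y.toGPSStar) (AdmissibleUpset X.toGPSStar) := f.toInfTopHom
  have hmono : ∀ {U V : AdmissibleUpset Y.toGPSStar}, U ≤ V → h U ≤ h V :=
    fun hUV => OrderHomClass.mono h hUV
  obtain ⟨⟨V₀, hV₀, hyV₀⟩, -⟩ := (Y.mem_base_iff y).1 hy
  have hdir : ∀ V V' : AdmissibleUpset Y.toGPSStar, y ∉ V.1 → y ∉ V'.1 →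
      ∃ W : AdmissibleUpset Y.toGPSStar, y ∉ W.1 ∧ V ≤ W ∧ V' ≤ W := by
    intro V V' hV hV'
    obtain ⟨W, hW, hyW, h1, h2⟩ := Y.exists_admissible_notMem hy V.2 V'.2 hV hV'
    exact ⟨⟨W, hW⟩, hyW, h1, h2⟩
  have hyW₀ : y ∉ (⟨V₀, hV₀⟩ : AdmissibleUpset Y.toGPSStar).1 := hyV₀
  have hcl : ∀ U V : AdmissibleUpset Y.toGPSStar, IsClosed ((h U).1 ∩ (h V).1ᶜ) :=
    fun U V => (h U).2.1.isClosed.inter (h V).2.1.compl.isClosed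
  let C : Set X.carrier := {v | ∀ U V : AdmissibleUpset Y.toGPSStar, y ∈ U.1 → y ∉ V.1 →
    v ∈ (h U).1 ∩ (h V).1ᶜ}
  have hC : IsClosed C := by
    simp only [C, Set.ofPred_forall]
    exact isClosed_iInter fun U => isClosed_iInter fun V => isClosed_iInter fun _ =>
      isClosed_iInter fun _ => hcl U V
  obtain ⟨x', hxx', hx'⟩ := exists_mem_forall_mem
    (𝒱 := {C | ∃ U V : AdmissibleUpset Y.toGPSStar, (y ∈ U.1 ∧ y ∉ V.1) ∧
      C = (h U).1 ∩ (h V).1ᶜ})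
    ⟨_, ⊤, _, ⟨trivial, hyW₀⟩, rfl⟩
    (by rintro _ ⟨U, V, -, rfl⟩; exact hcl U V)
    (by
      rintro _ ⟨U, V, ⟨hU, hV⟩, rfl⟩ _ ⟨U', V', ⟨hU', hV'⟩, rfl⟩
      obtain ⟨W, hyW, hVW, hVW'⟩ := hdir V V' hV hV'
      exact ⟨_, ⟨U ⊓ U', W, ⟨⟨hU, hU'⟩, hyW⟩, rfl⟩,
        Set.inter_subset_inter (hmono inf_le_left) (Set.compl_subset_compl.2 (hmono hVW)),
        Set.inter_subset_inter (hmono inf_le_right) (Set.compl_subset_compl.2 (hmono hVW'))⟩)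
    (isClosed_Ici' x)
    (by
      rintro _ ⟨U, V, ⟨hU, hV⟩, rfl⟩ hsub
      -- As `y ∈ U \ V`, the point `x` cannot lie in `h (U ⇨ V) = h U ⇨ h V`; hence some point above
      -- `x` lies in `h U \ h V`.
      refine GESStar.notMem_himp_iff.2 ⟨y, le_rfl, hU, hV⟩ (hxy (U ⇨ V) ?_)
      change x ∈ (f.toFun (U ⇨ V)).1
      rw [f.map_himp']
      by_contra hx
      obtain ⟨z, hxz, hz⟩ := GESStar.notMem_himp_iff.1 hx
      exact hsub hz hxz)
  obtain ⟨w, hx'w, hw⟩ := exists_maximal_ge hC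
    (show x' ∈ C from fun U V hU hV => hx' _ ⟨U, V, ⟨hU, hV⟩, rfl⟩)
  have hwU : ∀ U : AdmissibleUpset Y.toGPSStar, y ∈ U.1 → w ∈ (h U).1 :=
    fun U hU => (hw.1 U _ hU hyW₀).1
  have hwV : ∀ V : AdmissibleUpset Y.toGPSStar, y ∉ V.1 → w ∉ (h V).1 :=
    fun V hV => (hw.1 ⊤ V trivial hV).2
  refine ⟨w, ?_, le_trans hxx' hx'w, Set.ext fun v => ⟨fun hv => ?_, fun hv V hV => ?_⟩⟩
  · refine (X.mem_base_iff w).2 ⟨⟨_, (h ⟨V₀, hV₀⟩).2, hwV _ hyW₀⟩, ?_⟩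
    rintro A ⟨hA, hwA⟩ B ⟨hB, hwB⟩
    -- If no such pair existed, compactness would give `v ≥ w` in `C ∩ (A ∪ B)`; maximality forces
    -- `v = w`, although `w` avoids `A` and `B`. The pair makes `W ⇨ h V` the required bound of `A`
    -- and `B` avoiding `w`.
    obtain ⟨W, V, hwW, hyV, hsub⟩ : ∃ (W : AdmissibleUpset X.toGPSStar)
        (V : AdmissibleUpset Y.toGPSStar), w ∈ W.1 ∧ y ∉ V.1 ∧
          W.1 ∩ (h V).1ᶜ ⊆ (A ∪ B)ᶜ := by
      by_contra hcon
      obtain ⟨v, hvAB, hv⟩ := exists_mem_forall_mem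
        (𝒱 := {C | ∃ (W : AdmissibleUpset X.toGPSStar) (V : AdmissibleUpset Y.toGPSStar),
          (w ∈ W.1 ∧ y ∉ V.1) ∧ C = W.1 ∩ (h V).1ᶜ})
        ⟨_, ⊤, _, ⟨trivial, hyW₀⟩, rfl⟩
        (by
          rintro _ ⟨W, V, -, rfl⟩
          exact W.2.1.isClosed.inter (h V).2.1.compl.isClosed)
        (by
          rintro _ ⟨W, V, ⟨hW, hV⟩, rfl⟩ _ ⟨W', V', ⟨hW', hV'⟩, rfl⟩
          obtain ⟨V'', hyV, hVV, hVV'⟩ := hdir V V' hV hV'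
          exact ⟨_, ⟨W ⊓ W', V'', ⟨⟨hW, hW'⟩, hyV⟩, rfl⟩,
            Set.inter_subset_inter Set.inter_subset_left (Set.compl_subset_compl.2 (hmono hVV)),
            Set.inter_subset_inter Set.inter_subset_right
              (Set.compl_subset_compl.2 (hmono hVV'))⟩)
        (hA.1.isClosed.union hB.1.isClosed)
        (by
          rintro _ ⟨W, V, ⟨hW, hV⟩, rfl⟩ hsub
          exact hcon ⟨W, V, hW, hV, hsub⟩)
      have hwv : w ≤ v := (X.le_iff w v).2 fun W hW hwW =>
        (hv _ ⟨⟨W, hW⟩, _, ⟨hwW, hyW₀⟩, rfl⟩).1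
      have hvC : v ∈ C := fun U V hU hV =>
        ⟨(h U).2.2.1 hwv (hwU U hU), (hv _ ⟨⊤, V, ⟨trivial, hV⟩, rfl⟩).2⟩
      have hvw : v = w := le_antisymm (hw.2 hvC hwv) hwv
      exact (hvw ▸ hvAB).elim hwA hwB
    have key : ∀ T : AdmissibleUpset X.toGPSStar, T.1 ⊆ A ∪ B → T ≤ W ⇨ h V := by
      intro T hT
      rw [le_himp_iff_inf_le]
      intro t ht
      by_contra hn
      exact hsub ⟨ht.2, hn⟩ (hT ht.1)
    exact ⟨_, ⟨(W ⇨ h V).2, GESStar.notMem_himp_iff.2 ⟨w, le_rfl, hwW, hwV V hyV⟩⟩,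
      key ⟨A, hA⟩ Set.subset_union_left, key ⟨B, hB⟩ Set.subset_union_right⟩
  · exact (Y.le_iff y v).2 fun U hU hyU => hv ⟨U, hU⟩ (hwU ⟨U, hU⟩ hyU)
  · by_contra hvV
    exact hwV V (fun hyV => hvV (V.2.2.1 hv hyV)) hV

/-- The generalized Esakia morphism induced by a homomorphism of the implicative meet semilattices
of admissible clopen upsets. -/
def GEMorphism.ofHom {X Y : GESStar.{u}}
    (f : ImplicativeHom (AdmissibleUpset Y.toGPSStar) (AdmissibleUpset X.toGPSStar)) :
    GEMorphism X Y where
  toGPMorphism := GPMorphism.ofHom f.toInfTopHom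
  lift := GPMorphism.ofHom_lift f

/-- The implicative meet semilattice of admissible clopen upsets as an object of `IM`. -/
abbrev GESStar.toIM (X : GESStar.{u}) : IM.{u} :=
  ⟨AdmissibleUpset X.toGPSStar⟩

/-- The contravariant functor taking a `*`-generalized Esakia space to its implicative meet
semilattice of admissible clopen upsets. -/
def esakiaFunctor : GESStar.{u} ⥤ IM.{u}ᵒᵖ where
  obj X := Opposite.op X.toIM
  map {X Y} R := Quiver.Hom.op (X := Y.toIM) (Y := X.toIM) (GEMorphism.boxHom R)
  map_id X := Quiver.Hom.unop_inj <| ImplicativeHom.ext <|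
    InfHom.ext fun U => Subtype.ext (box_le X.toGPSStar U.2)
  map_comp R S := Quiver.Hom.unop_inj <| ImplicativeHom.ext <|
    InfHom.ext fun U => Subtype.ext (box_star R.rel S.rel U.2)

instance : esakiaFunctor.{u}.Faithful where
  map_injective {X Y R S} h := by
    have h' : GEMorphism.boxHom R = GEMorphism.boxHom S := congrArg Quiver.Hom.unop h
    exact GEMorphism.ext <| GPMorphism.boxHom_injective <| InfTopHom.ext fun U =>
      congrFun (congrArg (fun k => k.toFun) h') U

instance : esakiaFunctor.{u}.Full where
  map_surjective f := ⟨GEMorphism.ofHom f.unop, Quiver.Hom.unop_inj <| ImplicativeHom.ext <|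
    InfHom.ext fun U => DFunLike.congr_fun (GPMorphism.boxHom_ofHom f.unop.toInfTopHom) U⟩

/-! ### Essential surjectivity in the implicative case -/

/-- If `a ⇨ b` is not in the filter `x`, the filter generated by `x` and `a` misses `b`; a prime
extension missing `b` is the point above `x` sought. This supplies the Esakia condition for the dual
space. -/
theorem lowerClosure_basicUpset_diff {L : Type u} [ImplicativeSemilattice L] (a b : L) :
    (lowerClosure (basicUpset a \ basicUpset b) : Set (DualSpace L)) = (basicUpset (a ⇨ b))ᶜ := by
  ext x
  constructor
  · intro hx hab
    obtain ⟨y, hy, hxy⟩ := mem_lowerClosure.1 hx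
    exact hy.2 (basicUpset_mono (himp_inf_self_le a b)
      (y.isMeetFilter.inf_mem (isUpperSet_basicUpset _ hxy hab) hy.1))
  · intro hab
    have hb : b ∉ {d | ∃ f ∈ {c | x.1 c = true}, f ⊓ a ≤ d} := fun ⟨f, hf, hfa⟩ =>
      hab (x.isMeetFilter.mem_of_le (le_himp_iff_inf_le.2 hfa) hf)
    obtain ⟨y, -, hy, hyb⟩ := (x.isMeetFilter.adjoin a).exists_dualBase
      (isDistributiveMeet_of_implicative L) hb
    exact mem_lowerClosure.2 ⟨y, ⟨hy a ⟨⊤, x.isMeetFilter.top_mem, inf_le_right⟩, hyb⟩,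
      DualSpace.le_iff.2 fun c hc => hy c ⟨c, hc, inf_le_left⟩⟩

/-- The dual `*`-generalized Esakia space of an implicative meet semilattice. -/
def dualGESStar (L : Type u) [ImplicativeSemilattice L] : GESStar.{u} where
  toGPSStar := dualGPSStar L (isDistributiveMeet_of_implicative L)
  isClopen_lowerClosure := by
    rintro _ ⟨n, A, B, hA, hB, rfl⟩
    rw [lowerClosure_iUnion, LowerSet.coe_iSup]
    refine isClopen_iUnion_of_finite fun i => ?_
    obtain ⟨a, ha⟩ := exists_eq_basicUpset (hA i)
    obtain ⟨b, hb⟩ := exists_eq_basicUpset (hB i)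
    rw [ha, hb]
    exact (lowerClosure_basicUpset_diff a b).symm ▸ (isClopen_basicUpset _).compl

/-- An order isomorphism between implicative meet semilattices preserves implication. -/
def ImplicativeHom.ofOrderIso {L K : Type u} [ImplicativeSemilattice L]
    [ImplicativeSemilattice K] (e : L ≃o K) : ImplicativeHom L K where
  toFun := e
  map_inf' := e.map_inf
  map_himp' a b := eq_of_forall_le_iff fun c => by
    rw [le_himp_iff_inf_le, ← e.symm_apply_le, le_himp_iff_inf_le, ← e.symm_apply_le,
      e.symm.map_inf, e.symm_apply_apply]

/-- An order isomorphism between implicative meet semilattices is an isomorphism in `IM`. -/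
def IM.isoOfOrderIso {L K : IM.{u}} (e : L.carrier ≃o K.carrier) : L ≅ K where
  hom := ImplicativeHom.ofOrderIso e
  inv := ImplicativeHom.ofOrderIso e.symm
  hom_inv_id := ImplicativeHom.ext <| InfHom.ext e.symm_apply_apply
  inv_hom_id := ImplicativeHom.ext <| InfHom.ext e.apply_symm_apply

instance : esakiaFunctor.{u}.EssSurj where
  mem_essImage L := ⟨dualGESStar L.unop.carrier,
    ⟨(IM.isoOfOrderIso (K := (dualGESStar L.unop.carrier).toIM)
      (dualOrderIso (isDistributiveMeet_of_implicative L.unop.carrier))).op⟩⟩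

end MeetDuality

theorem mainTheorem12 :
    Nonempty (MeetDuality.DM.{u}ᵒᵖ ≌ MeetDuality.GPSStar.{u}) ∧
    Nonempty (MeetDuality.IM.{u}ᵒᵖ ≌ MeetDuality.GESStar.{u}) :=
  ⟨⟨(@Functor.asEquivalence _ _ _ _ MeetDuality.admissibleFunctor.{u} {}).symm⟩,
    ⟨(@Functor.asEquivalence _ _ _ _ MeetDuality.esakiaFunctor.{u} {}).symm⟩⟩
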